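/- Let $G$ be a finite abelian group of order $v$, written additively. A $(v,k,\lambda)$ difference set in $G$ is a $k$-element subset $D\subseteq G$ such that every non-identity element $g\in G$ can be written as $g=a-b$ with $a,b\in D$ in exactly $\lambda$ ways. Write $C_m$ for the cyclic group of order $m$ and $\exp(G)$ for the exponent of $G$. Then no difference set exists with the following parameters in the following groups: 1. $(343,171,85)$ in $C_7\times C_{49}$; 2. $(768,118,18)$ in $C_4\times C_{192}$; 3. $(768,118,18)$ in $C_8\times C_{96}$; 4. $(5859,203,7)$ in $C_{5859}$; 5. $(675,337,168)$ in $C_5\times C_{135}$; 6. $(783,391,195)$ in $C_3\times C_{261}$. Moreover, let $p=7,2,2,3,3,3$ and $i=1,1,1,1,2,2$ in cases 1–6 respectively, let $n=k-\lambda$, and let $t=\exp(G)/p+1$. Then in each case the following hold. (a) Both $s=t$ and $s=t^i$ satisfy: $\gcd(s,v)=1$; for every prime $q\mid n$, with $w_q$ denoting the $q$-free part of $\exp(G)$ (that is, $\exp(G)$ divided by the largest power of $q$ dividing it), either $q^{j}\equiv -1\pmod{w_q}$ for some integer $j$, or $s\equiv q^{j}\pmod{w_q}$ for some integer $j$; and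 $\dfrac{n}{\gcd(n,v)}>\lambda$. (b) There are an integer $e\ge 2$ and a finite abelian group $H$ with $G\cong C_{p^e}\times H$ such that the Sylow $p$-subgroup of $H$ has exponent less than $p^e$, $t^i\equiv 1+p^{e-1}\pmod{p^e}$ and $t^i\equiv 1\pmod{\exp(H)}$; and it is not the case that $p=2$, $G$ is non-cyclic and $(v,k,\lambda)=(4u^2,2u^2-u,u^2-u)$ for some positive integer $u$. -/

import Mathlib

/-- `D` is a `(v, k, l)` difference set in the (additively written) abelian group `G`: `G` has
order `v`, `D` has `k` elements, and every non-identity element of `G` is a difference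
`a - b` of elements `a, b` of `D` in exactly `l` ways. -/
structure IsDifferenceSet {G : Type*} [AddCommGroup G] [DecidableEq G]
    (D : Finset G) (v k l : ℕ) : Prop where
  card_group : Nat.card G = v
  card_eq : D.card = k
  card_differences : ∀ g : G, g ≠ 0 →
    ((D ×ˢ D).filter (fun x : G × G => x.1 - x.2 = g)).card = l

/-- `m` is self-conjugate modulo `n`: for every prime `p ∣ m`, some power of `p` is `-1` modulo
the `p`-free part of `n`.  (As `p` has finite order modulo that number, natural exponents give the
same notion as integer exponents.) -/
def SelfConjugateMod (m n : ℕ) : Prop :=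
  ∀ p : ℕ, p.Prime → p ∣ m → ∃ j : ℕ, (p : ℤ) ^ j ≡ -1 [ZMOD ((n / p ^ padicValNat p n : ℕ) : ℤ)]

/-- The arithmetic hypotheses on `t` of the multiplier theorem for `(v, k, l)` difference
sets in the abelian group `G`, for the divisor `n₁ = n = k - l` of the order `n`, in the
form `n₁ / gcd (n₁, v) > l`. -/
def MultiplierHypotheses (G : Type*) [AddCommGroup G] (v k l : ℕ) (t : ℤ) : Prop :=
  IsCoprime t (v : ℤ) ∧
  (∀ p : ℕ, p.Prime → p ∣ k - l →
    SelfConjugateMod p (AddMonoid.exponent G) ∨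
    ∃ j : ℕ, t ≡ (p : ℤ) ^ j
      [ZMOD ((AddMonoid.exponent G / p ^ padicValNat p (AddMonoid.exponent G) : ℕ) : ℤ)]) ∧
  (l : ℚ) < ((k - l : ℕ) : ℚ) / (Nat.gcd (k - l) v : ℚ)

/-- `(v, k, l)` are the parameters of a Hadamard difference set. -/
def IsHadamardParameters (v k l : ℕ) : Prop :=
  ∃ u : ℕ, 0 < u ∧ v = 4 * u ^ 2 ∧ k = 2 * u ^ 2 - u ∧ l = u ^ 2 - u

/-- The integer `t` is forbidden, at the prime `p`, as a multiplier of `(v, k, l)` difference sets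
in the abelian group `G`: `G` is isomorphic to `C_{p^e} × H` with `e ≥ 2` and `H` a finite abelian
group whose Sylow `p`-subgroup has exponent less than `p ^ e`, `t ≡ 1 + p ^ (e - 1)` modulo `p ^ e`,
`t ≡ 1` modulo the exponent of `H`, and it is not the case that `p = 2`, the parameters are
those of a Hadamard difference set, and `G` is not cyclic. -/
def IsForbiddenMultiplier (G : Type) [AddCommGroup G] (v k l p : ℕ) (t : ℤ) : Prop :=
  p.Prime ∧
  (∃ (e : ℕ) (H : Type) (_ : AddCommGroup H), 2 ≤ e ∧ Finite H ∧
    Nonempty (G ≃+ ZMod (p ^ e) × H) ∧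
    (∀ P : Sylow p (Multiplicative H), Monoid.exponent P < p ^ e) ∧
    t ≡ 1 + (p : ℤ) ^ (e - 1) [ZMOD (p : ℤ) ^ e] ∧
    t ≡ 1 [ZMOD (AddMonoid.exponent H : ℤ)]) ∧
  ¬ (p = 2 ∧ IsHadamardParameters v k l ∧ ¬ IsAddCyclic G)

/-- The facts recorded for one group in the table, for `t = exp(G) / p + 1`: no `(v, k, l)`
difference set exists in `G`; `t` and its power `t ^ i` satisfy the hypotheses of the multiplier
theorem with `n₁ = n`; and `t ^ i` satisfies the conditions that forbid it as a multiplier.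
(Powers of multipliers are multipliers, so for `i = 1`, and also for general `i`, the number `t` is
itself excluded as a multiplier.) -/
def IsRuledOut (G : Type) [AddCommGroup G] [DecidableEq G] (v k l p i : ℕ) : Prop :=
  (¬ ∃ D : Finset G, IsDifferenceSet D v k l) ∧
  MultiplierHypotheses G v k l ((AddMonoid.exponent G / p + 1 : ℕ) : ℤ) ∧
  MultiplierHypotheses G v k l (((AddMonoid.exponent G / p + 1 : ℕ) : ℤ) ^ i) ∧
  IsForbiddenMultiplier G v k l p (((AddMonoid.exponent G / p + 1 : ℕ) : ℤ) ^ i)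

/-! Write n = k - λ and let s = t^i. If D were a difference set, the multiplier theorem would make
multiplication by s carry D to a translate of itself. In these groups, however, s acts as a
transvection x ↦ x + φ(x)π, with φ onto C_p and π of order p in ker φ, and counting shows that this
is impossible.

Multiplier theorem: let F(g) be the number of ways to write g = s•a - b with a, b in D. At a
nontrivial character ψ the Fourier transform of F is σ(x)·c(x), where x = ψ(D), c is complex
conjugation, σ raises roots of unity to the power s, and x·c(x) = n. Every prime over n is fixed by
c or by σ, so valuations give n ∣ σ(x)c(x) (`natCast_dvd_mul_of_norm_eq`). Fourier inversion yields
n ∣ v(F(g) - λ), and n/gcd(n,v) > λ then forces F ≥ λ. The first two moments of F leave only the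
values λ and k, and F(g) = k means that sD - g = D.

Contradiction: after a translation D is s-invariant, so its part outside ker φ is a union of cosets
of ⟨π⟩. That part yields representations of π as a difference, so it has at most λ elements and |D ∩
ker φ| ≥ n. But Cauchy-Schwarz keeps |D ∩ ker φ| near k/p (`IsDifferenceSet.sq_card_filter_le`). -/

/-! ### Prime ideals fixed by an automorphism, and valuations -/

/-- In a ring generated by an `N`-th root of unity `ζ`, a ring automorphism `σ` with
`σ ζ = ζ ^ s`, where `s` is a power of the prime `q` modulo the `q`-free part of `N`, stabilizes
every prime ideal that contains `q`. -/
theorem comap_eq_of_modEq_prime_pow {O : Type*} [CommRing O] {ζ : O} {N q m w s j : ℕ}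
    (hζ : ζ ^ N = 1) (htop : Algebra.adjoin ℤ {ζ} = ⊤) (hq : q.Prime) (hN : N = q ^ m * w)
    (hs : s ≡ q ^ j [MOD w]) (σ : O ≃+* O) (hσ : σ ζ = ζ ^ s)
    (P : Ideal O) [P.IsPrime] (hP : (q : O) ∈ P) : P.comap σ = P := by
  have : Fact q.Prime := ⟨hq⟩
  have hch : CharP (O ⧸ P) q := by
    rw [CharP.charP_iff_prime_eq_zero hq]
    simpa using Ideal.Quotient.eq_zero_iff_mem.2 hP
  -- Modulo P, both y ↦ σ(y)^(q^m) and y ↦ y^(q^(m+j)) are ring homomorphisms. The extra power q^m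
  -- absorbs the q-part of N, so that s ≡ q^j modulo w alone makes them agree on ζ, hence
  -- everywhere.
  let f : O →ₐ[ℤ] O ⧸ P :=
    ((iterateFrobenius (O ⧸ P) q m).comp ((Ideal.Quotient.mk P).comp (σ : O →+* O))).toIntAlgHom
  let g : O →ₐ[ℤ] O ⧸ P :=
    ((iterateFrobenius (O ⧸ P) q (m + j)).comp (Ideal.Quotient.mk P)).toIntAlgHom
  have hfg : f = g := by
    refine AlgHom.ext_of_adjoin_eq_top htop ?_
    rintro z hz
    rw [Set.mem_singleton_iff.1 hz]
    have hord : ζ ^ (s * q ^ m) = ζ ^ (q ^ (m + j)) := by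
      have h : s * q ^ m ≡ q ^ (m + j) [MOD N] := by
        rw [hN, pow_add, mul_comm s]
        exact hs.mul_left' _
      have h' := h.of_dvd (orderOf_dvd_of_pow_eq_one hζ)
      exact pow_eq_pow_of_modEq h' (pow_orderOf_eq_one ζ)
    change (Ideal.Quotient.mk P (σ ζ)) ^ q ^ m = (Ideal.Quotient.mk P ζ) ^ q ^ (m + j)
    rw [hσ, ← map_pow, ← map_pow, ← pow_mul, hord]
  ext y
  have h := DFunLike.congr_fun hfg y
  replace h : Ideal.Quotient.mk P (σ y) ^ q ^ m = Ideal.Quotient.mk P y ^ q ^ (m + j) := h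
  rw [← map_pow (Ideal.Quotient.mk P), ← map_pow (Ideal.Quotient.mk P)] at h
  rw [Ideal.mem_comap, ← Ideal.IsPrime.pow_mem_iff_mem ‹P.IsPrime› (q ^ m) (pow_pos hq.pos m),
    ← Ideal.Quotient.eq_zero_iff_mem, h, Ideal.Quotient.eq_zero_iff_mem,
    Ideal.IsPrime.pow_mem_iff_mem ‹P.IsPrime› _ (pow_pos hq.pos _)]

theorem emultiplicity_span_apply_eq {O : Type*} [CommRing O] [IsDedekindDomain O] (σ : O ≃+* O)
    {P : Ideal O} (hP : P.comap σ = P) (x : O) :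
    emultiplicity P (Ideal.span {σ x}) = emultiplicity P (Ideal.span {x}) := by
  rw [emultiplicity_eq_emultiplicity_iff]
  intro n
  have hpow : (P ^ n).comap σ = P ^ n := by
    have h : P.map σ.symm = P := by rw [Ideal.map_symm]; exact hP
    have := Ideal.map_pow σ.symm P n
    rw [h, Ideal.map_symm] at this
    exact this
  rw [Ideal.dvd_span_singleton, Ideal.dvd_span_singleton]
  conv_rhs => rw [← hpow]
  rw [Ideal.mem_comap]

theorem dvd_of_forall_emultiplicity_le {O : Type*} [CommRing O] [IsDedekindDomain O] {a b : O}
    (ha : a ≠ 0)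
    (h : ∀ P : Ideal O, P.IsPrime → P ≠ ⊥ →
      emultiplicity P (Ideal.span {a}) ≤ emultiplicity P (Ideal.span {b})) : a ∣ b := by
  rw [← Ideal.span_singleton_le_span_singleton, ← Ideal.dvd_iff_le]
  have ha' : Ideal.span {a} ≠ ⊥ := by simpa using ha
  by_cases hb : Ideal.span {b} = ⊥
  · rw [hb]; exact dvd_zero _
  rw [UniqueFactorizationMonoid.dvd_iff_emultiplicity_le ha']
  intro P hP
  exact h P (Ideal.isPrime_of_prime hP) hP.ne_zero

/-- Checked at each prime P containing n. If σ fixes P, then σ x and x have the same valuation and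
the norm equation suffices. If c fixes P, applying σ to the norm equation shows that the valuation
of n is twice that of x and also twice that of σ x. -/
theorem natCast_dvd_mul_of_norm_eq {O : Type*} [CommRing O] [IsDedekindDomain O] [CharZero O]
    (σ c : O ≃+* O) {n : ℕ} (hn : n ≠ 0) {x : O} (hcomm : σ (c x) = c (σ x))
    (hx : x * c x = n)
    (h : ∀ q : ℕ, q.Prime → q ∣ n →
      (∀ P : Ideal O, P.IsPrime → (q : O) ∈ P → P.comap c = P) ∨
      (∀ P : Ideal O, P.IsPrime → (q : O) ∈ P → P.comap σ = P)) :
    (n : O) ∣ σ x * c x := by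
  refine dvd_of_forall_emultiplicity_le (Nat.cast_ne_zero.2 hn) fun P hP hP0 => ?_
  by_cases hmem : (n : O) ∈ P
  swap
  · rw [emultiplicity_eq_zero.2 (by rwa [Ideal.dvd_span_singleton])]
    exact zero_le
  have hprime : Prime P := Ideal.prime_of_isPrime hP0 hP
  have hmul (a b : O) : emultiplicity P (Ideal.span {a * b}) =
      emultiplicity P (Ideal.span {a}) + emultiplicity P (Ideal.span {b}) := by
    rw [← Ideal.span_singleton_mul_span_singleton, emultiplicity_mul hprime]
  obtain ⟨q, hq, hqn, hqP⟩ : ∃ q : ℕ, q.Prime ∧ q ∣ n ∧ (q : O) ∈ P := by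
    rw [← Nat.prod_primeFactorsList hn, Nat.cast_list_prod, ← Multiset.prod_coe,
      hP.multiset_prod_mem_iff_exists_mem] at hmem
    obtain ⟨y, hy, hyP⟩ := hmem
    obtain ⟨q, hq, rfl⟩ := List.mem_map.1 hy
    exact ⟨q, Nat.prime_of_mem_primeFactorsList hq, Nat.dvd_of_mem_primeFactorsList hq, hyP⟩
  rcases h q hq hqn with hc | hσ
  · have hc' := emultiplicity_span_apply_eq c (hc P hP hqP)
    have h1 : emultiplicity P (Ideal.span {(n : O)}) =
        emultiplicity P (Ideal.span {x}) + emultiplicity P (Ideal.span {x}) := by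
      rw [← hx, hmul, hc']
    have h2 : emultiplicity P (Ideal.span {(n : O)}) =
        emultiplicity P (Ideal.span {σ x}) + emultiplicity P (Ideal.span {σ x}) := by
      have h3 : σ x * c (σ x) = n := by rw [← hcomm, ← map_mul, hx, map_natCast]
      rw [← h3, hmul, hc']
    rw [hmul, hc']
    rw [h1] at h2
    have h4 : emultiplicity P (Ideal.span {x}) ≤ emultiplicity P (Ideal.span {σ x}) := by
      by_contra! hlt
      exact (ENat.add_lt_add hlt hlt).ne h2.symm
    rw [h1]
    gcongr
  · rw [hmul, emultiplicity_span_apply_eq σ (hσ P hP hqP), ← hmul, hx]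

/-! ### Cyclotomic integers -/

/-- The automorphism of the ring of integers of a cyclotomic field that raises a primitive root of
unity to the power `s`. -/
theorem exists_ringEquiv_ringOfIntegers_cyclotomic {N : ℕ} [NeZero N] {K : Type*} [Field K]
    [CharZero K] [IsCyclotomicExtension {N} ℚ K]
    {ζ : NumberField.RingOfIntegers K} (hζ : IsPrimitiveRoot ζ N) {s : ℕ} (hs : s.Coprime N) :
    ∃ σ : NumberField.RingOfIntegers K ≃+* NumberField.RingOfIntegers K, σ ζ = ζ ^ s := by
  have hirr := Polynomial.cyclotomic.irreducible_rat (NeZero.pos N)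
  have hζ' : IsPrimitiveRoot (ζ : K) N :=
    hζ.map_of_injective NumberField.RingOfIntegers.coe_injective
  have hmin : minpoly ℚ (ζ : K) = minpoly ℚ ((ζ : K) ^ s) := by
    rw [← hζ'.minpoly_eq_cyclotomic_of_irreducible hirr,
      ← (hζ'.pow_of_coprime s hs).minpoly_eq_cyclotomic_of_irreducible hirr]
  let e := (hζ'.powerBasis ℚ).equivOfMinpoly ((hζ'.pow_of_coprime s hs).powerBasis ℚ)
    (by simpa only [IsPrimitiveRoot.powerBasis_gen] using hmin)
  refine ⟨NumberField.RingOfIntegers.mapRingEquiv (e : K ≃+* K), ?_⟩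
  apply NumberField.RingOfIntegers.coe_injective
  have h := (hζ'.powerBasis ℚ).equivOfMinpoly_gen ((hζ'.pow_of_coprime s hs).powerBasis ℚ)
    (by simpa only [IsPrimitiveRoot.powerBasis_gen] using hmin)
  simp only [IsPrimitiveRoot.powerBasis_gen] at h
  rw [map_pow]
  exact h

theorem adjoin_eq_top_ringOfIntegers_cyclotomic {N : ℕ} [NeZero N] {K : Type*} [Field K]
    [CharZero K] [IsCyclotomicExtension {N} ℚ K]
    {ζ : NumberField.RingOfIntegers K} (hζ : IsPrimitiveRoot ζ N) :
    Algebra.adjoin ℤ {ζ} = ⊤ :=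
  IsCyclotomicExtension.Rat.adjoin_singleton_eq_top
    (hζ.map_of_injective NumberField.RingOfIntegers.coe_injective)

/-- The quotient is rational and integral over ℤ, hence an integer. This brings divisibility of
character sums back to divisibility of counts. -/
theorem intCast_dvd_ringOfIntegers_iff {K : Type*} [Field K] [CharZero K] {a b : ℤ}
    (h : (a : NumberField.RingOfIntegers K) ∣ (b : NumberField.RingOfIntegers K)) : a ∣ b := by
  rcases eq_or_ne a 0 with rfl | ha
  · rw [Int.cast_zero, zero_dvd_iff, Int.cast_eq_zero] at h
    simp [h]
  obtain ⟨y, hy⟩ := h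
  have hy' : (y : K) = algebraMap ℚ K ((b : ℚ) / a) := by
    have h1 := congrArg (algebraMap (NumberField.RingOfIntegers K) K) hy
    simp only [map_mul, map_intCast] at h1
    have ha' : (a : K) ≠ 0 := Int.cast_ne_zero.2 ha
    rw [map_div₀, map_intCast, map_intCast, eq_div_iff ha', h1, mul_comm]
  have hint : IsIntegral ℤ ((b : ℚ) / a) := by
    rw [← isIntegral_algebraMap_iff (B := K) (algebraMap ℚ K).injective, ← hy']
    exact y.isIntegral_coe
  obtain ⟨c, hc⟩ := IsIntegrallyClosed.algebraMap_eq_of_integral hint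
  refine ⟨c, ?_⟩
  have ha' : (a : ℚ) ≠ 0 := Int.cast_ne_zero.2 ha
  rw [eq_div_iff ha'] at hc
  have : c * a = b := by
    rw [eq_intCast] at hc
    exact_mod_cast hc
  rw [← this, mul_comm]

/-! ### Characters with values in the ring of integers -/

theorem addChar_sum_apply_eq_ite {G : Type*} [AddCommGroup G] [Finite G] {O : Type*} [CommRing O] [IsDomain O]
    [HasEnoughRootsOfUnity O (AddMonoid.exponent G)]
    [Fintype (AddChar G O)] [CharZero O] [DecidableEq G] (a : G) :
    ∑ ψ : AddChar G O, ψ a = if a = 0 then (Nat.card G : O) else 0 := by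
  classical
  have : HasEnoughRootsOfUnity O (Monoid.exponent (Multiplicative G)) := by
    rw [Monoid.exponent_multiplicative]; infer_instance
  have hcard : Fintype.card (AddChar G O) = Nat.card G := by
    rw [← Nat.card_eq_fintype_card,
      Nat.card_congr (AddChar.toMonoidHomEquiv.trans MonoidHom.toHomUnitsMulEquiv.toEquiv),
      CommGroup.card_monoidHom_of_hasEnoughRootsOfUnity]
    rfl
  split_ifs with ha
  · simp [ha, hcard]
  · have hne : AddChar.doubleDualEmb (M := O) a ≠ 0 := by
      obtain ⟨φ, hφ⟩ := CommGroup.exists_apply_ne_one_of_hasEnoughRootsOfUnity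
        (Multiplicative G) O (a := Multiplicative.ofAdd a) (by simpa using ha)
      rw [AddChar.ne_zero_iff]
      refine ⟨AddChar.toMonoidHomEquiv.symm (MonoidHom.toHomUnitsMulEquiv.symm φ), fun h => hφ ?_⟩
      exact Units.ext h
    exact AddChar.sum_eq_zero_iff_ne_zero.2 hne

theorem addChar_apply_pow_exponent {G : Type*} [AddCommGroup G] {O : Type*} [CommRing O] (ψ : AddChar G O) (x : G) :
    ψ x ^ AddMonoid.exponent G = 1 := by
  rw [← AddChar.map_nsmul_eq_pow, AddMonoid.exponent_nsmul_eq_zero, AddChar.map_zero_eq_one]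

/-- Multiplication by `s` on the arguments of characters is induced by an automorphism, which
stabilizes every prime ideal over `q` if `s` is a power of `q` modulo the `q`-free part of the
exponent. -/
theorem exists_ringEquiv_addChar {G : Type*} [AddCommGroup G] [Finite G] {K : Type*} [Field K] [CharZero K]
    [IsCyclotomicExtension {AddMonoid.exponent G} ℚ K] {s : ℤ}
    (hs : IsCoprime s (AddMonoid.exponent G : ℤ)) :
    ∃ σ : NumberField.RingOfIntegers K ≃+* NumberField.RingOfIntegers K,
      (∀ (ψ : AddChar G (NumberField.RingOfIntegers K)) (x : G), σ (ψ x) = ψ (s • x)) ∧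
      ∀ q j : ℕ, q.Prime → s ≡ (q : ℤ) ^ j
          [ZMOD ((AddMonoid.exponent G / q ^ padicValNat q (AddMonoid.exponent G) : ℕ) : ℤ)] →
        ∀ P : Ideal (NumberField.RingOfIntegers K), P.IsPrime →
          (q : NumberField.RingOfIntegers K) ∈ P → P.comap σ = P := by
  set N := AddMonoid.exponent G with hN
  have hN0 : N ≠ 0 := AddMonoid.exponent_ne_zero_of_finite
  have : NeZero N := ⟨hN0⟩
  have hζ := IsPrimitiveRoot.toInteger_isPrimitiveRoot (IsCyclotomicExtension.zeta_spec N ℚ K)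
  generalize (IsCyclotomicExtension.zeta_spec N ℚ K).toInteger = ζ at hζ
  obtain ⟨s', hs'⟩ : ∃ s' : ℕ, (s' : ℤ) ≡ s [ZMOD (N : ℤ)] :=
    ⟨(s % N).toNat, by
      rw [Int.toNat_of_nonneg (Int.emod_nonneg _ (by exact_mod_cast hN0))]
      exact Int.mod_modEq _ _⟩
  have hcop : s'.Coprime N := by
    obtain ⟨c, hc⟩ := hs'.dvd
    rw [← Nat.isCoprime_iff_coprime, show (s' : ℤ) = s + N * -c by linarith]
    exact hs.add_mul_left_left _
  obtain ⟨σ, hσ⟩ := exists_ringEquiv_ringOfIntegers_cyclotomic (K := K) hζ hcop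
  refine ⟨σ, fun ψ x => ?_, fun q j hq hj P hP hqP => ?_⟩
  · obtain ⟨i, -, hi⟩ := hζ.eq_pow_of_pow_eq_one (addChar_apply_pow_exponent ψ x)
    have hsx : s • x = s' • x := by
      obtain ⟨c, hc⟩ := hs'.dvd
      rw [show s = s' + c * N by linarith, add_zsmul, natCast_zsmul, mul_zsmul, natCast_zsmul, hN,
        AddMonoid.exponent_nsmul_eq_zero, smul_zero, add_zero]
    rw [hsx, AddChar.map_nsmul_eq_pow, ← hi, map_pow, hσ, ← pow_mul, ← pow_mul, mul_comm]
  · refine comap_eq_of_modEq_prime_pow (q := q) (m := padicValNat q N)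
      (w := N / q ^ padicValNat q N) hζ.pow_eq_one
      (adjoin_eq_top_ringOfIntegers_cyclotomic hζ) hq
      (Nat.mul_div_cancel' pow_padicValNat_dvd).symm (j := j) ?_ σ hσ P hqP
    rw [← Int.natCast_modEq_iff, Nat.cast_pow]
    refine (hs'.of_dvd ?_).trans hj
    exact Int.natCast_dvd_natCast.2 (Nat.div_dvd_of_dvd pow_padicValNat_dvd)

/-! ### Twisted difference counts and their moments -/

theorem zsmul_eq_zero_iff_of_isCoprime {G : Type*} [AddCommGroup G] {s : ℤ}
    (hs : IsCoprime s (Nat.card G : ℤ)) {x : G} :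
    s • x = 0 ↔ x = 0 := by
  refine ⟨fun h => ?_, fun h => by rw [h, smul_zero]⟩
  obtain ⟨a, b, hab⟩ := hs
  rw [← one_zsmul x, ← hab, add_zsmul, mul_zsmul, mul_zsmul, h, natCast_zsmul, card_nsmul_eq_zero',
    smul_zero, smul_zero, add_zero]

/-- The number of representations of `g` as `s • a - b` with `a`, `b` in `D`. -/
def twistedCount {G : Type*} [AddCommGroup G] [DecidableEq G] (D : Finset G) (s : ℤ) (g : G) : ℕ :=
  ((D ×ˢ D).filter (fun x : G × G => s • x.1 - x.2 = g)).card

theorem twistedCount_eq_sum {G : Type*} [AddCommGroup G] [DecidableEq G] {R : Type*}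
    [CommRing R] (D : Finset G) (s : ℤ) (g : G) :
    (twistedCount D s g : R) = ∑ a ∈ D, ∑ b ∈ D, if s • a - b = g then 1 else 0 := by
  rw [twistedCount, ← Finset.sum_product', Finset.sum_boole]

theorem IsDifferenceSet.card_filter_eq_ite {G : Type*} [AddCommGroup G] [DecidableEq G]
    {D : Finset G} {v k l : ℕ} (hD : IsDifferenceSet D v k l) (g : G) :
    ((D ×ˢ D).filter (fun x : G × G => x.1 - x.2 = g)).card = if g = 0 then k else l := by
  split_ifs with hg
  · subst hg
    rw [← hD.card_eq]
    refine (congrArg Finset.card ?_).trans (Finset.diag_card D)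
    ext ⟨a, b⟩
    simp only [Finset.mem_filter, Finset.mem_product, sub_eq_zero, Finset.mem_diag]
    constructor
    · rintro ⟨⟨ha, -⟩, h⟩
      exact ⟨ha, h⟩
    · rintro ⟨ha, rfl⟩
      exact ⟨⟨ha, ha⟩, rfl⟩
  · exact hD.card_differences g hg

section Counting

variable {G : Type*} [AddCommGroup G] [Fintype G] [DecidableEq G] {D : Finset G} {v k l : ℕ}

/-- The group-ring identity D·D⁻¹ = (k - λ) + λG, paired with an arbitrary function. Constants,
characters and indicators of subgroups are substituted for f later. -/
theorem IsDifferenceSet.sum_sub {R : Type*} [CommRing R] (hD : IsDifferenceSet D v k l)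
    (f : G → R) :
    ∑ x ∈ D, ∑ y ∈ D, f (x - y) = ((k : R) - l) * f 0 + l * ∑ g, f g := by
  rw [← Finset.sum_product', ← Finset.sum_fiberwise (D ×ˢ D) (fun x : G × G => x.1 - x.2)]
  have h (g : G) : ∑ x ∈ (D ×ˢ D).filter (fun x : G × G => x.1 - x.2 = g), f (x.1 - x.2) =
      (if g = 0 then ((k : R) - l) * f 0 else 0) + l * f g := by
    rw [Finset.sum_congr rfl (g := fun _ => f g)
      (fun x hx => by rw [(Finset.mem_filter.1 hx).2]), Finset.sum_const, nsmul_eq_mul,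
      hD.card_filter_eq_ite]
    split_ifs with hg
    · subst hg; ring
    · ring
  rw [Finset.sum_congr rfl (fun g _ => h g), Finset.sum_add_distrib, ← Finset.mul_sum]
  simp

theorem IsDifferenceSet.sq_eq (hD : IsDifferenceSet D v k l) :
    (k : ℤ) ^ 2 = (k - l) + l * v := by
  have h := hD.sum_sub (fun _ => (1 : ℤ))
  have hv : (Fintype.card G : ℤ) = v := by rw [← Nat.card_eq_fintype_card, hD.card_group]
  simp only [Finset.sum_const, hD.card_eq, Finset.card_univ, nsmul_eq_mul, mul_one, hv] at h
  linarith

theorem sum_twistedCount_mul {R : Type*} [CommRing R] (D : Finset G) (s : ℤ) (f : G → R) :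
    ∑ g, (twistedCount D s g : R) * f g = ∑ a ∈ D, ∑ b ∈ D, f (s • a - b) := by
  simp_rw [twistedCount_eq_sum, Finset.sum_mul]
  rw [Finset.sum_comm]
  refine Finset.sum_congr rfl fun a _ => ?_
  rw [Finset.sum_comm]
  refine Finset.sum_congr rfl fun b _ => ?_
  simp

/-- The sum counts quadruples with s•a' - b' = s•a - b, that is b - b' = s•(a - a'). For given a, a'
there are k or λ pairs (b, b'), according to whether a = a'; coprimality of s to v makes s•(a - a')
= 0 equivalent to that. -/
theorem IsDifferenceSet.sum_twistedCount_sq (hD : IsDifferenceSet D v k l) {s : ℤ}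
    (hs : IsCoprime s (v : ℤ)) :
    ∑ g, (twistedCount D s g : ℤ) ^ 2 = (k - l) * k + l * (k - l + l * v) := by
  have hv : (Fintype.card G : ℤ) = v := by rw [← Nat.card_eq_fintype_card, hD.card_group]
  simp_rw [pow_two]
  rw [sum_twistedCount_mul]
  simp_rw [twistedCount_eq_sum]
  have h1 : ∀ a ∈ D, ∑ b ∈ D, ∑ a' ∈ D, ∑ b' ∈ D,
        (if s • a' - b' = s • a - b then (1 : ℤ) else 0) =
      ∑ a' ∈ D, (if s • (a - a') = 0 then (k : ℤ) else l) := by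
    intro a _
    rw [Finset.sum_comm]
    refine Finset.sum_congr rfl fun a' _ => ?_
    have h2 := hD.card_filter_eq_ite (s • (a - a'))
    rw [← Finset.sum_product', Finset.sum_boole]
    have h3 : (D ×ˢ D).filter (fun x : G × G => s • a' - x.2 = s • a - x.1) =
        (D ×ˢ D).filter (fun x : G × G => x.1 - x.2 = s • (a - a')) := by
      refine Finset.filter_congr fun x _ => ?_
      rw [smul_sub]
      constructor <;> intro h
      · rw [← sub_eq_zero] at h ⊢; rw [← h]; abel
      · rw [← sub_eq_zero] at h ⊢; rw [← h]; abel
    rw [h3, h2]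
    push_cast
    rfl
  rw [Finset.sum_congr rfl h1, hD.sum_sub (fun x => if s • x = 0 then (k : ℤ) else l)]
  have h4 (g : G) : (if s • g = 0 then (k : ℤ) else l) = (if g = 0 then (k : ℤ) - l else 0) + l := by
    rw [← hD.card_group] at hs
    simp only [zsmul_eq_zero_iff_of_isCoprime hs]
    split_ifs <;> ring
  simp_rw [h4, Finset.sum_add_distrib]
  simp only [if_true, Finset.sum_ite_eq', Finset.mem_univ, Finset.sum_const,
    Finset.card_univ, nsmul_eq_mul, hv]
  ring

theorem IsDifferenceSet.exists_twistedCount_eq (hD : IsDifferenceSet D v k l) {s : ℤ}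
    (hs : IsCoprime s (v : ℤ)) (hlk : l < k) (h : ∀ g, l ≤ twistedCount D s g) :
    ∃ g, twistedCount D s g = k := by
  have hv : (Fintype.card G : ℤ) = v := by rw [← Nat.card_eq_fintype_card, hD.card_group]
  have hsq := hD.sq_eq
  have hsum : ∑ g, ((twistedCount D s g : ℤ) - l) = k - l := by
    have := sum_twistedCount_mul D s (fun _ => (1 : ℤ))
    simp only [mul_one, Finset.sum_const, hD.card_eq, nsmul_eq_mul] at this
    rw [Finset.sum_sub_distrib, this]
    simp only [Finset.sum_const, Finset.card_univ, nsmul_eq_mul, hv]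
    linarith
  have hnn (g : G) : 0 ≤ (twistedCount D s g : ℤ) - l := by
    have := h g; omega
  have hle (g : G) : (twistedCount D s g : ℤ) - l ≤ k - l := by
    rw [← hsum]
    exact Finset.single_le_sum (f := fun g => (twistedCount D s g : ℤ) - l) (fun i _ => hnn i)
      (Finset.mem_univ g)
  -- With F the twisted count, 0 ≤ F - λ ≤ k - λ makes every term nonnegative, while the two moments
  -- make the sum vanish. So each F - λ is 0 or k - λ, and its positive total rules out 0
  -- throughout.
  have hsq_sum : ∑ g, ((twistedCount D s g : ℤ) - l) * ((k - l) - ((twistedCount D s g : ℤ) - l))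
      = 0 := by
    have h1 (g : G) : ((twistedCount D s g : ℤ) - l) * ((k - l) - ((twistedCount D s g : ℤ) - l)) =
        (k - l) * ((twistedCount D s g : ℤ) - l) - (twistedCount D s g : ℤ) ^ 2
          + 2 * l * ((twistedCount D s g : ℤ) - l) + l ^ 2 := by ring
    simp_rw [h1, Finset.sum_add_distrib,
      Finset.sum_sub_distrib (f := fun g => ((k : ℤ) - l) * ((twistedCount D s g : ℤ) - l)),
      ← Finset.mul_sum, hsum, hD.sum_twistedCount_sq hs]
    simp only [Finset.sum_const, Finset.card_univ, nsmul_eq_mul, hv]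
    ring
  have hzero := (Finset.sum_eq_zero_iff_of_nonneg
    (fun g _ => mul_nonneg (hnn g) (sub_nonneg.2 (hle g)))).1 hsq_sum
  by_contra! hne
  have : ∀ g ∈ Finset.univ, (twistedCount D s g : ℤ) - l = 0 := by
    intro g hg
    rcases mul_eq_zero.1 (hzero g hg) with h0 | h0
    · exact h0
    · exact absurd (by omega) (hne g)
  rw [Finset.sum_eq_zero this] at hsum
  omega

end Counting

/-- A pair counted at g is determined by its first coordinate, so k such pairs use every element of
D. Thus x ↦ s•x - g maps D into D, and injectivity makes it onto. -/
theorem IsDifferenceSet.mem_iff_of_twistedCount_eq {G : Type*} [AddCommGroup G] [DecidableEq G]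
    {D : Finset G} {v k l : ℕ} (hD : IsDifferenceSet D v k l) {s : ℤ}
    (hs : IsCoprime s (v : ℤ)) {g : G} (hg : twistedCount D s g = k) (x : G) :
    s • x - g ∈ D ↔ x ∈ D := by
  have hinj : Function.Injective (fun x : G => s • x - g) := by
    intro a b hab
    rw [← hD.card_group] at hs
    rw [← sub_eq_zero, ← zsmul_eq_zero_iff_of_isCoprime hs, smul_sub, sub_eq_zero]
    simpa using hab
  have hsub : ∀ a ∈ D, s • a - g ∈ D := by
    have himg : ((D ×ˢ D).filter (fun x : G × G => s • x.1 - x.2 = g)).image Prod.fst = D := by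
      refine Finset.eq_of_subset_of_card_le ?_ ?_
      · intro a ha
        obtain ⟨x, hx, rfl⟩ := Finset.mem_image.1 ha
        exact (Finset.mem_product.1 (Finset.mem_filter.1 hx).1).1
      · rw [Finset.card_image_of_injOn, hD.card_eq, ← hg, twistedCount]
        rintro ⟨a, b⟩ hx ⟨a', b'⟩ hy hxy
        have h1 := (Finset.mem_filter.1 hx).2
        have h2 := (Finset.mem_filter.1 hy).2
        simp only at hxy h1 h2
        subst hxy
        rw [← h2] at h1
        simpa using h1
    intro a ha
    rw [← himg] at ha
    obtain ⟨⟨a', b⟩, hx, rfl⟩ := Finset.mem_image.1 ha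
    obtain ⟨hx1, hx2⟩ := Finset.mem_filter.1 hx
    have : s • a' - g = b := by rw [← hx2]; abel
    rw [this]
    exact (Finset.mem_product.1 hx1).2
  have hD' : D.image (fun x : G => s • x - g) = D :=
    Finset.eq_of_subset_of_card_le (Finset.image_subset_iff.2 hsub)
      (Finset.card_image_of_injective _ hinj).ge
  refine ⟨fun h => ?_, hsub x⟩
  rw [← hD'] at h
  obtain ⟨y, hy, hyx⟩ := Finset.mem_image.1 h
  rwa [← hinj hyx]

/-! ### The multiplier theorem -/

theorem IsDifferenceSet.sum_addChar_mul {G : Type*} [AddCommGroup G] [Finite G] [DecidableEq G]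
    {D : Finset G} {v k l : ℕ} (hD : IsDifferenceSet D v k l) {O : Type*} [CommRing O] [IsDomain O]
    [CharZero O] {ψ : AddChar G O} (hψ : ψ ≠ 0) :
    (∑ a ∈ D, ψ a) * ∑ b ∈ D, ψ (-b) = k - l := by
  have := Fintype.ofFinite G
  have h := hD.sum_sub (fun x => ψ x)
  simp_rw [sub_eq_add_neg, AddChar.map_add_eq_mul, ← Finset.mul_sum, ← Finset.sum_mul] at h
  rw [h, AddChar.sum_eq_zero_iff_ne_zero.2 hψ, AddChar.map_zero_eq_one]
  ring

theorem natCast_dvd_sum_addChar_mul {G : Type*} [AddCommGroup G] [Finite G] [DecidableEq G]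
    {K : Type*} [Field K] [CharZero K] [IsCyclotomicExtension {AddMonoid.exponent G} ℚ K]
    {D : Finset G} {v k l : ℕ} {s : ℤ} (hD : IsDifferenceSet D v k l)
    (hs : MultiplierHypotheses G v k l s) (hlk : l < k)
    {ψ : AddChar G (NumberField.RingOfIntegers K)} (hψ : ψ ≠ 0) :
    ((k - l : ℕ) : NumberField.RingOfIntegers K) ∣
      (∑ a ∈ D, ψ (s • a)) * ∑ b ∈ D, ψ (-b) := by
  have : NumberField K := IsCyclotomicExtension.numberField {AddMonoid.exponent G} ℚ K
  have hdvd : (AddMonoid.exponent G : ℤ) ∣ v := by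
    rw [← hD.card_group]
    exact Int.natCast_dvd_natCast.2 AddGroup.exponent_dvd_nat_card
  obtain ⟨hcop, hprimes, -⟩ := hs
  obtain ⟨σ, hσ, hσP⟩ := exists_ringEquiv_addChar (G := G) (K := K)
    (hcop.of_isCoprime_of_dvd_right hdvd)
  obtain ⟨c, hc, hcP⟩ := exists_ringEquiv_addChar (G := G) (K := K) (s := -1)
    (isCoprime_one_left.neg_left)
  have hσD : σ (∑ a ∈ D, ψ a) = ∑ a ∈ D, ψ (s • a) := by simp_rw [map_sum, hσ]
  have hcD : c (∑ a ∈ D, ψ a) = ∑ a ∈ D, ψ (-a) := by simp_rw [map_sum, hc, neg_one_zsmul]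
  rw [← hσD, ← hcD]
  refine natCast_dvd_mul_of_norm_eq σ c (by omega) ?_ ?_ ?_
  · simp_rw [map_sum, hc, hσ, hc, smul_comm s]
  · rw [hcD, hD.sum_addChar_mul hψ, Nat.cast_sub hlk.le]
  · intro q hq hqn
    rcases hprimes q hq hqn with h | ⟨j, hj⟩
    · obtain ⟨j, hj⟩ := h q hq dvd_rfl
      exact Or.inl (hcP q j hq hj.symm)
    · exact Or.inr (hσP q j hq hj)

/-- Fourier inversion: v times the count is a sum over characters. The trivial one contributes k² =
(k - λ) + λv, whose λv is moved to the left, and every other term is divisible by k - λ. -/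
theorem sub_dvd_card_mul_twistedCount_sub {G : Type*} [AddCommGroup G] [Finite G] [DecidableEq G]
    (K : Type*) [Field K] [CharZero K] [IsCyclotomicExtension {AddMonoid.exponent G} ℚ K]
    {D : Finset G} {v k l : ℕ} {s : ℤ} (hD : IsDifferenceSet D v k l)
    (hs : MultiplierHypotheses G v k l s) (hlk : l < k) (g : G) :
    ((k - l : ℕ) : ℤ) ∣ v * ((twistedCount D s g : ℤ) - l) := by
  classical
  have := Fintype.ofFinite G
  have : NeZero (AddMonoid.exponent G) := ⟨AddMonoid.exponent_ne_zero_of_finite⟩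
  have hζ := IsPrimitiveRoot.toInteger_isPrimitiveRoot
    (IsCyclotomicExtension.zeta_spec (AddMonoid.exponent G) ℚ K)
  have hroots : HasEnoughRootsOfUnity (NumberField.RingOfIntegers K) (AddMonoid.exponent G) :=
    ⟨⟨_, hζ⟩, rootsOfUnity.isCyclic _ _⟩
  have hfin : Finite (AddChar G (NumberField.RingOfIntegers K)) := by
    have : HasEnoughRootsOfUnity (NumberField.RingOfIntegers K)
        (Monoid.exponent (Multiplicative G)) := by
      rw [Monoid.exponent_multiplicative]; infer_instance
    exact Finite.of_equiv _ ((AddChar.toMonoidHomEquiv.trans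
      MonoidHom.toHomUnitsMulEquiv.toEquiv).trans
      (CommGroup.monoidHom_mulEquiv_of_hasEnoughRootsOfUnity (Multiplicative G)
        (NumberField.RingOfIntegers K)).some.toEquiv).symm
  have := Fintype.ofFinite (AddChar G (NumberField.RingOfIntegers K))
  apply intCast_dvd_ringOfIntegers_iff (K := K)
  have hfourier : (v : NumberField.RingOfIntegers K) * twistedCount D s g =
      ∑ ψ : AddChar G (NumberField.RingOfIntegers K),
        ψ (-g) * ((∑ a ∈ D, ψ (s • a)) * ∑ b ∈ D, ψ (-b)) := by
    rw [twistedCount_eq_sum, Finset.mul_sum]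
    simp_rw [Finset.sum_mul_sum, Finset.mul_sum]
    rw [Finset.sum_comm (s := Finset.univ)]
    refine Finset.sum_congr rfl fun a _ => ?_
    rw [Finset.sum_comm]
    refine Finset.sum_congr rfl fun b _ => ?_
    simp_rw [← AddChar.map_add_eq_mul]
    rw [addChar_sum_apply_eq_ite, hD.card_group]
    have : -g + (s • a + -b) = 0 ↔ s • a - b = g := by
      rw [neg_add_eq_zero, ← sub_eq_add_neg, eq_comm]
    simp only [this, mul_ite, mul_one, mul_zero]
  have hsq := hD.sq_eq
  have h0 : (v : NumberField.RingOfIntegers K) * ((twistedCount D s g) - l) = (k - l : ℕ) +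
      ∑ ψ ∈ Finset.univ.erase (0 : AddChar G (NumberField.RingOfIntegers K)),
        ψ (-g) * ((∑ a ∈ D, ψ (s • a)) * ∑ b ∈ D, ψ (-b)) := by
    rw [mul_sub, hfourier, ← Finset.add_sum_erase _ _ (Finset.mem_univ 0)]
    simp only [AddChar.zero_apply, Finset.sum_const, hD.card_eq, nsmul_eq_mul, mul_one, one_mul]
    have hsq' : (k : NumberField.RingOfIntegers K) ^ 2 = (k - l) + l * v := by
      have h := congrArg (fun z : ℤ => (z : NumberField.RingOfIntegers K)) hsq
      push_cast at h
      exact h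
    rw [Nat.cast_sub hlk.le]
    linear_combination hsq'
  rw [Int.cast_natCast, Int.cast_mul, Int.cast_sub, Int.cast_natCast, Int.cast_natCast,
    Int.cast_natCast]
  rw [h0]
  refine dvd_add dvd_rfl (Finset.dvd_sum fun ψ hψ => Dvd.dvd.mul_left ?_ _)
  exact natCast_dvd_sum_addChar_mul hD hs hlk (Finset.ne_of_mem_erase hψ)

/-- The multiplier theorem. -/
theorem IsDifferenceSet.exists_translate_of_multiplierHypotheses {G : Type*} [AddCommGroup G]
    [Finite G] [DecidableEq G] {D : Finset G} {v k l : ℕ} {s : ℤ} (hD : IsDifferenceSet D v k l)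
    (hs : MultiplierHypotheses G v k l s) :
    ∃ g : G, ∀ x, s • x - g ∈ D ↔ x ∈ D := by
  have := Fintype.ofFinite G
  have hlk : l < k := by
    by_contra! hle
    have h := hs.2.2
    rw [Nat.sub_eq_zero_of_le hle, Nat.cast_zero, zero_div] at h
    exact (Nat.cast_nonneg (α := ℚ) l).not_gt h
  have : NeZero ((AddMonoid.exponent G : ℕ) : ℚ) :=
    ⟨by exact_mod_cast AddMonoid.exponent_ne_zero_of_finite⟩
  have : IsCyclotomicExtension {AddMonoid.exponent G} ℚ
      (CyclotomicField (AddMonoid.exponent G) ℚ) :=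
    CyclotomicField.isCyclotomicExtension _ ℚ
  have hcount (g : G) : l ≤ twistedCount D s g := by
    by_contra! hlt
    have hpos : 0 < Nat.gcd (k - l) v := Nat.gcd_pos_of_pos_left _ (by omega)
    have hdvd : (k - l) ∣ v * (l - twistedCount D s g) := by
      have h := sub_dvd_card_mul_twistedCount_sub 
        (CyclotomicField (AddMonoid.exponent G) ℚ) hD hs hlk g
      rw [← Int.natCast_dvd_natCast, Nat.cast_mul, Nat.cast_sub hlt.le, ← dvd_neg,
        neg_mul_eq_mul_neg, neg_sub]
      exact h
    -- A positive deficit λ - F(g) ≤ λ would be a multiple of n/gcd(n, v), which exceeds λ.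
    have hdvd' : (k - l) / Nat.gcd (k - l) v ∣ l - twistedCount D s g :=
      (Nat.coprime_div_gcd_div_gcd hpos).dvd_of_dvd_mul_left
        (by
          rw [← Nat.mul_div_right_comm (Nat.gcd_dvd_right _ _)]
          exact Nat.div_dvd_div (Nat.gcd_dvd_left _ _) hdvd)
    have hle := Nat.le_of_dvd (by omega) hdvd'
    have hlast := hs.2.2
    rw [← Nat.cast_div (Nat.gcd_dvd_left _ _) (by exact_mod_cast hpos.ne'), Nat.cast_lt] at hlast
    omega
  obtain ⟨g, hg⟩ := hD.exists_twistedCount_eq hs.1 hlk hcount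
  exact ⟨g, hD.mem_iff_of_twistedCount_eq hs.1 hg⟩

/-! ### Intersections with translates and with subgroups -/

theorem IsDifferenceSet.card_le_of_sub_mem {G : Type*} [AddCommGroup G] [DecidableEq G]
    {D S : Finset G} {v k l : ℕ} (hD : IsDifferenceSet D v k l) {h : G} (hh : h ≠ 0) (hS : S ⊆ D)
    (hsub : ∀ x ∈ S, x - h ∈ D) : S.card ≤ l := by
  rw [← hD.card_differences h hh]
  refine Finset.card_le_card_of_injOn (fun x => (x, x - h)) (fun x hx => ?_)
    (fun x _ y _ hxy => (Prod.mk.inj hxy).1)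
  simp [hS hx, hsub x hx]

theorem IsDifferenceSet.image_sub {G : Type*} [AddCommGroup G] [DecidableEq G]
    {D : Finset G} {v k l : ℕ} (hD : IsDifferenceSet D v k l) (c : G) :
    IsDifferenceSet (D.image (· - c)) v k l where
  card_group := hD.card_group
  card_eq := by rw [Finset.card_image_of_injective _ (sub_left_injective), hD.card_eq]
  card_differences g hg := by
    rw [← hD.card_differences g hg]
    symm
    refine Finset.card_bij (fun x _ => (x.1 - c, x.2 - c)) ?_ ?_ ?_
    · rintro ⟨a, b⟩ hx
      simpa using hx
    · rintro ⟨a, b⟩ _ ⟨a', b'⟩ _ h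
      simpa using h
    · rintro ⟨a, b⟩ hx
      simp only [Finset.mem_filter, Finset.mem_product, Finset.mem_image] at hx
      obtain ⟨⟨⟨a', ha, rfl⟩, b', hb, rfl⟩, h⟩ := hx
      refine ⟨(a', b'), ?_, rfl⟩
      simpa [ha, hb] using h

/-- The number of elements of a difference set in a subgroup of index `m` is close to `k / m`. -/
theorem IsDifferenceSet.sq_card_filter_le {G : Type*} [AddCommGroup G] [DecidableEq G] [Finite G]
    {D : Finset G} {v k l : ℕ} (hD : IsDifferenceSet D v k l) {Q : Type*} [AddCommGroup Q]
    [Fintype Q] [DecidableEq Q] (φ : G →+ Q) (hφ : Function.Surjective φ) :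
    ((Fintype.card Q : ℤ) * (D.filter (fun x => φ x = 0)).card - k) ^ 2 ≤
      (Fintype.card Q - 1) ^ 2 * (k - l) := by
  have := Fintype.ofFinite G
  have hv : (Fintype.card G : ℤ) = v := by rw [← Nat.card_eq_fintype_card, hD.card_group]
  set d : Q → ℤ := fun c => ((D.filter (fun x => φ x = c)).card : ℤ) with hd
  have hdsum : ∑ c, d c = k := by
    rw [← hD.card_eq, Finset.card_eq_sum_card_fiberwise (f := φ) (t := Finset.univ)
      (fun _ _ => Finset.mem_univ _)]
    push_cast
    rfl
  have hker : (Fintype.card Q : ℤ) * ∑ g : G, (if φ g = 0 then 1 else 0) = v := by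
    have hfib (c : Q) : (Finset.univ.filter (fun x : G => φ x = c)).card =
        (Finset.univ.filter (fun x : G => φ x = 0)).card := by
      obtain ⟨y, rfl⟩ := hφ c
      refine Finset.card_bij (fun x _ => x - y) ?_ ?_ ?_
      · intro x hx
        simpa [sub_eq_zero] using hx
      · intro x _ z _ h
        simpa using h
      · intro x hx
        refine ⟨x + y, ?_, by abel⟩
        simpa using hx
    have h1 := Finset.card_eq_sum_card_fiberwise (f := φ) (s := (Finset.univ : Finset G))
      (t := Finset.univ) (fun _ _ => Finset.mem_univ _)
    simp_rw [hfib, Finset.sum_const, Finset.card_univ, smul_eq_mul] at h1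
    rw [Finset.sum_boole, ← hv, h1]
    push_cast
    rfl
  have hdsq : ∑ c, d c ^ 2 = (k - l) + l * ∑ g : G, (if φ g = 0 then 1 else 0) := by
    have h1 := hD.sum_sub (fun x => if φ x = 0 then (1 : ℤ) else 0)
    rw [map_zero, if_pos rfl, mul_one] at h1
    rw [← h1]
    have h2 (c : Q) : d c ^ 2 = ∑ x ∈ D, ∑ y ∈ D,
        (if φ x = c then (1 : ℤ) else 0) * (if φ y = c then 1 else 0) := by
      rw [← Finset.sum_mul_sum, Finset.sum_boole, pow_two]
    simp_rw [h2]
    rw [Finset.sum_comm]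
    refine Finset.sum_congr rfl fun x _ => ?_
    rw [Finset.sum_comm]
    refine Finset.sum_congr rfl fun y _ => ?_
    simp only [map_sub, sub_eq_zero, mul_ite, mul_one, mul_zero, Finset.sum_ite_eq,
      Finset.mem_univ, if_true]
  -- Cauchy-Schwarz over the nonzero classes only. Multiplying by |Q| and using |Q|·|ker φ| = v with
  -- k² = (k - λ) + λv completes the square around k.
  have hcs : (k - d 0) ^ 2 ≤ ((Fintype.card Q : ℤ) - 1) * (∑ c, d c ^ 2 - d 0 ^ 2) := by
    have h1 := sq_sum_le_card_mul_sum_sq (s := Finset.univ.erase (0 : Q)) (f := d)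
    rw [Finset.card_erase_of_mem (Finset.mem_univ _), Finset.card_univ,
      Nat.cast_sub Fintype.card_pos] at h1
    rw [← hdsum, ← Finset.add_sum_erase _ d (Finset.mem_univ 0),
      ← Finset.add_sum_erase _ (fun c => d c ^ 2) (Finset.mem_univ 0)]
    simpa using h1
  have hsq := hD.sq_eq
  have hq : (0 : ℤ) ≤ Fintype.card Q := Int.natCast_nonneg _
  change ((Fintype.card Q : ℤ) * d 0 - k) ^ 2 ≤ _
  generalize (∑ g : G, if φ g = 0 then (1 : ℤ) else 0) = z at *
  rw [hdsq] at hcs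
  have h1 := mul_le_mul_of_nonneg_left hcs hq
  have h2 : (l : ℤ) * v = k ^ 2 - (k - l) := by linarith
  rw [← hker] at h2
  linear_combination h1 + ((Fintype.card Q : ℤ) - 1) * h2

/-! ### Transvections are not multipliers -/

/-- Multiplication by `s` is the transvection `x ↦ x + φ x • π`, where `φ` maps the group onto
`C_p` and `π` is an element of order `p` of the kernel of `φ`. -/
structure IsTransvection {G : Type*} [AddCommGroup G] {p : ℕ} (s : ℤ) (φ : G →+ ZMod p)
    (π : G) : Prop where
  surjective : Function.Surjective φ
  ne_zero : π ≠ 0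
  nsmul_eq_zero : p • π = 0
  map_eq_zero : φ π = 0
  zsmul_eq : ∀ x, s • x = x + (φ x).val • π

theorem zsmul_eq_zsmul_of_intCast_eq {G : Type*} [AddCommGroup G] {p : ℕ} {π : G}
    (h : p • π = 0) {a b : ℤ} (hab : (a : ZMod p) = b) : a • π = b • π := by
  obtain ⟨c, hc⟩ := (ZMod.intCast_eq_intCast_iff_dvd_sub _ _ _).1 hab
  rw [show b = a + c * p by linarith, add_zsmul, mul_zsmul, natCast_zsmul π p, h, smul_zero,
    add_zero]

namespace IsTransvection

variable {G : Type*} [AddCommGroup G] {p : ℕ} {s : ℤ} {φ : G →+ ZMod p} {π : G}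

theorem mem_sub_of_invariant [DecidableEq G] (h : IsTransvection s φ π) (hp : p.Prime)
    {D : Finset G} (hinv : ∀ x, s • x ∈ D ↔ x ∈ D) {x : G} (hx : x ∈ D) (hφ : φ x ≠ 0) :
    x - π ∈ D := by
  have : Fact p.Prime := ⟨hp⟩
  have hiter (m : ℕ) : x + (m * (φ x).val) • π ∈ D := by
    induction m with
    | zero => simpa using hx
    | succ m ih =>
      rw [← hinv, h.zsmul_eq] at ih
      have : φ (x + (m * (φ x).val) • π) = φ x := by
        rw [map_add, map_nsmul, h.map_eq_zero, smul_zero, add_zero]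
      rw [this, add_assoc, ← add_nsmul] at ih
      convert ih using 3
      ring
  -- φ x is constant along the orbit and invertible modulo p, so this number of steps adds exactly
  -- -π.
  have hm := hiter (-(φ x)⁻¹).val
  have hval : ((-(φ x)⁻¹).val * (φ x).val) • π + π = 0 := by
    rw [← succ_nsmul, ← zero_zsmul π, ← natCast_zsmul]
    refine zsmul_eq_zsmul_of_intCast_eq h.nsmul_eq_zero ?_
    push_cast
    rw [ZMod.natCast_zmod_val, ZMod.natCast_zmod_val, neg_mul, inv_mul_cancel₀ hφ]
    ring
  rwa [eq_neg_of_add_eq_zero_left hval, ← sub_eq_add_neg] at hm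

/-- Let S be the sum of the elements of D. Summing over sD - g = D gives S = s•S - k•g = S + φ(S)π -
k•g, so k•g is a multiple of π, and k is invertible modulo v. -/
theorem exists_eq_zsmul_of_coprime [DecidableEq G] [Finite G] (h : IsTransvection s φ π)
    {D : Finset G} {v k l : ℕ} (hD : IsDifferenceSet D v k l) (hs : IsCoprime s (v : ℤ)) {g : G}
    (hg : ∀ x, s • x - g ∈ D ↔ x ∈ D) (hkv : k.Coprime v) : ∃ j : ℤ, g = j • π := by
  have hinj : Function.Injective (fun x : G => s • x - g) := by
    intro a b hab
    rw [← hD.card_group] at hs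
    rw [← sub_eq_zero, ← zsmul_eq_zero_iff_of_isCoprime hs, smul_sub, sub_eq_zero]
    simpa using hab
  have himg : D.image (fun x : G => s • x - g) = D :=
    Finset.eq_of_subset_of_card_le (Finset.image_subset_iff.2 fun x hx => (hg x).2 hx)
      (Finset.card_image_of_injective _ hinj).ge
  have hsum : ∑ x ∈ D, x = s • (∑ x ∈ D, x) - k • g := by
    conv_lhs => rw [← himg, Finset.sum_image (fun x _ y _ hxy => hinj hxy)]
    rw [Finset.sum_sub_distrib, Finset.sum_const, hD.card_eq, Finset.smul_sum]
  rw [h.zsmul_eq, add_sub_assoc, left_eq_add, sub_eq_zero] at hsum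
  obtain ⟨a, b, hab⟩ := Nat.isCoprime_iff_coprime.2 hkv
  refine ⟨a * (φ (∑ x ∈ D, x)).val, ?_⟩
  rw [mul_zsmul, natCast_zsmul, hsum, ← natCast_zsmul, ← mul_zsmul]
  conv_lhs => rw [← one_zsmul g, ← hab, add_zsmul, mul_zsmul _ b, natCast_zsmul g v,
    ← hD.card_group, card_nsmul_eq_zero', smul_zero, add_zero]

/-- On the fibre φ = c the map x ↦ s•x - g is subtraction of g - cπ. If this were never zero, each
of the p fibres of D would have at most λ elements, giving k ≤ pλ. -/
theorem exists_eq_zsmul_of_lt [DecidableEq G] [Finite G] (h : IsTransvection s φ π) (hp : p.Prime)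
    {D : Finset G} {v k l : ℕ} (hD : IsDifferenceSet D v k l) {g : G}
    (hg : ∀ x, s • x - g ∈ D ↔ x ∈ D) (hlk : p * l < k) : ∃ j : ℤ, g = j • π := by
  have : Fact p.Prime := ⟨hp⟩
  by_contra! hne
  have hfib (c : ZMod p) : (D.filter (fun x => φ x = c)).card ≤ l := by
    refine hD.card_le_of_sub_mem (h := g - c.val • π)
      (sub_ne_zero.2 fun h0 => hne c.val (by rw [natCast_zsmul, h0]))
      (Finset.filter_subset _ _) fun x hx => ?_
    obtain ⟨hxD, hxc⟩ := Finset.mem_filter.1 hx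
    rw [← hg, h.zsmul_eq, hxc] at hxD
    rwa [sub_sub_eq_add_sub]
  have hsum := Finset.card_eq_sum_card_fiberwise (f := φ) (s := D) (t := Finset.univ)
    (fun _ _ => Finset.mem_univ _)
  have hle := Finset.sum_le_sum (s := Finset.univ) (fun c _ => hfib c)
  rw [← hsum, hD.card_eq, Finset.sum_const, Finset.card_univ, ZMod.card, smul_eq_mul] at hle
  omega

theorem not_invariant [DecidableEq G] [Finite G] (h : IsTransvection s φ π) (hp : p.Prime)
    {D : Finset G} {v k l : ℕ} (hD : IsDifferenceSet D v k l) (hlk : l ≤ k)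
    (hk : k < p * (k - l)) (hineq : (p - 1) ^ 2 * (k - l) < (p * (k - l) - k) ^ 2) :
    ¬ ∀ x, s • x ∈ D ↔ x ∈ D := by
  have : Fact p.Prime := ⟨hp⟩
  intro hinv
  have h1 : (D.filter (fun x => ¬ φ x = 0)).card ≤ l := by
    refine hD.card_le_of_sub_mem h.ne_zero (Finset.filter_subset _ _) fun x hx => ?_
    obtain ⟨hxD, hxc⟩ := Finset.mem_filter.1 hx
    exact h.mem_sub_of_invariant hp hinv hxD hxc
  have h2 := Finset.card_filter_add_card_filter_not (s := D) (fun x => φ x = 0)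
  have h3 := hD.sq_card_filter_le φ h.surjective
  rw [hD.card_eq] at h2
  rw [ZMod.card] at h3
  zify [hp.one_le, hlk, hk.le] at hk hineq h1 h2
  have h4 : (p : ℤ) * (k - l) ≤ p * (D.filter (fun x => φ x = 0)).card := by
    apply mul_le_mul_of_nonneg_left _ (Int.natCast_nonneg p)
    linarith
  have h5 : ((p : ℤ) * (k - l) - k) ^ 2 ≤ (p * (D.filter (fun x => φ x = 0)).card - k) ^ 2 := by
    apply pow_le_pow_left₀ <;> linarith
  linarith

theorem not_multiplier [DecidableEq G] [Finite G] (h : IsTransvection s φ π) (hp : p.Prime)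
    {D : Finset G} {v k l : ℕ} (hD : IsDifferenceSet D v k l) (hs : IsCoprime s (v : ℤ))
    (hlk : l ≤ k) (hk : k < p * (k - l)) (hineq : (p - 1) ^ 2 * (k - l) < (p * (k - l) - k) ^ 2)
    (hfix : k.Coprime v ∨ p * l < k) (g : G) : ¬ ∀ x, s • x - g ∈ D ↔ x ∈ D := by
  have : Fact p.Prime := ⟨hp⟩
  intro hg
  obtain ⟨j, rfl⟩ : ∃ j : ℤ, g = j • π := by
    rcases hfix with hfix | hfix
    · exact h.exists_eq_zsmul_of_coprime hD hs hg hfix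
    · exact h.exists_eq_zsmul_of_lt hp hD hg hfix
  -- Since s•c = c + φ(c)π, translating D by c with φ(c) = j absorbs the shift jπ.
  obtain ⟨c, hc⟩ := h.surjective (j : ZMod p)
  refine h.not_invariant hp (hD.image_sub c) hlk hk hineq fun x => ?_
  have hmem (y : G) : y ∈ D.image (· - c) ↔ y + c ∈ D := by
    simp [sub_eq_iff_eq_add]
  rw [hmem, hmem, ← hg (x + c), smul_add, h.zsmul_eq c, hc]
  have : (j : ZMod p).val • π = j • π := by
    rw [← natCast_zsmul]
    exact zsmul_eq_zsmul_of_intCast_eq h.nsmul_eq_zero (by simp)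
  rw [this, ← add_assoc, add_sub_cancel_right]

end IsTransvection

/-- On C_{p^e}, multiplication by 1 + p^(e-1) adds p^(e-1)·a, which depends only on a modulo p; on H
it is the identity. So φ is the first coordinate modulo p and π is p^(e-1), which φ kills because e
≥ 2. -/
theorem exists_isTransvection {G : Type*} [AddCommGroup G] {p e : ℕ} (hp : p.Prime) (he : 2 ≤ e)
    {H : Type*} [AddCommGroup H] (f : G ≃+ ZMod (p ^ e) × H) {s : ℤ}
    (hs : s ≡ 1 + (p : ℤ) ^ (e - 1) [ZMOD (p : ℤ) ^ e])
    (hsH : s ≡ 1 [ZMOD (AddMonoid.exponent H : ℤ)]) :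
    ∃ (φ : G →+ ZMod p) (π : G), IsTransvection s φ π := by
  have : Fact p.Prime := ⟨hp⟩
  have hpe : NeZero (p ^ e) := ⟨(pow_pos hp.pos e).ne'⟩
  have hdvd : p ∣ p ^ e := dvd_pow_self p (by omega)
  have hpow : p * p ^ (e - 1) = p ^ e := by rw [← pow_succ']; congr 1; omega
  let c : ZMod (p ^ e) →+* ZMod p := ZMod.castHom hdvd _
  let φ : G →+ ZMod p := (c.toAddMonoidHom.comp (AddMonoidHom.fst _ H)).comp f.toAddMonoidHom
  let π : G := f.symm (((p ^ (e - 1) : ℕ) : ZMod (p ^ e)), 0)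
  refine ⟨φ, π, ?_, ?_, ?_, ?_, ?_⟩
  · intro y
    obtain ⟨x, hx⟩ := ZMod.castHom_surjective hdvd y
    refine ⟨f.symm (x, 0), ?_⟩
    change c (f (f.symm (x, 0))).1 = y
    rw [f.apply_symm_apply]
    exact hx
  · intro h0
    have h1 := (AddEquiv.map_eq_zero_iff f.symm).1 h0
    have h2 := (ZMod.natCast_eq_zero_iff _ _).1 (Prod.ext_iff.1 h1).1
    have h3 := (Nat.pow_dvd_pow_iff_le_right hp.one_lt).1 h2
    omega
  · change p • f.symm _ = 0
    rw [← map_nsmul, AddEquiv.map_eq_zero_iff, Prod.smul_mk, smul_zero, nsmul_eq_mul,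
      ← Nat.cast_mul, hpow, ZMod.natCast_self]
    rfl
  · change c (f (f.symm _)).1 = 0
    rw [f.apply_symm_apply, map_natCast, ZMod.natCast_eq_zero_iff]
    exact dvd_pow_self p (by omega)
  · intro x
    apply f.injective
    change _ = f (x + (c (f x).1).val • f.symm _)
    rw [map_zsmul, map_add, map_nsmul, f.apply_symm_apply]
    obtain ⟨a, h⟩ := f x
    have ha : s • a = a + (c a).val • ((p ^ (e - 1) : ℕ) : ZMod (p ^ e)) := by
      have hs' : (s : ZMod (p ^ e)) = 1 + ((p ^ (e - 1) : ℕ) : ZMod (p ^ e)) := by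
        have := (ZMod.intCast_eq_intCast_iff s (1 + (p : ℤ) ^ (e - 1)) (p ^ e)).2
          (by exact_mod_cast hs)
        rw [this]
        push_cast
        rfl
      obtain ⟨m, rfl⟩ := ZMod.natCast_zmod_surjective a
      rw [zsmul_eq_mul, hs', add_mul, one_mul, map_natCast, ZMod.val_natCast, nsmul_eq_mul,
        ← Nat.cast_mul, ← Nat.cast_mul]
      congr 1
      rw [ZMod.natCast_eq_natCast_iff, mul_comm, ← hpow]
      exact (Nat.mod_modEq m p).symm.mul_right' _
    have hh : s • h = h := by
      obtain ⟨d, hd⟩ := hsH.symm.dvd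
      rw [show s = 1 + d * (AddMonoid.exponent H : ℤ) by linarith, add_zsmul, one_zsmul, mul_zsmul,
        natCast_zsmul, AddMonoid.exponent_nsmul_eq_zero, smul_zero, add_zero]
    rw [Prod.smul_mk, ha, hh, Prod.smul_mk, smul_zero, Prod.mk_add_mk, add_zero]

/-! ### Reduction to numerical checks -/

theorem exponent_sylow_lt {H : Type*} [AddCommGroup H] [Finite H] {p e f r : ℕ} (hp : p.Prime)
    (hH : AddMonoid.exponent H ∣ p ^ f * r) (hr : ¬ p ∣ r) (hfe : f < e)
    (P : Sylow p (Multiplicative H)) : Monoid.exponent P < p ^ e := by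
  have : Fact p.Prime := ⟨hp⟩
  obtain ⟨n, hn⟩ := IsPGroup.iff_card.1 P.isPGroup'
  have h1 : Monoid.exponent P ∣ p ^ n := hn ▸ Group.exponent_dvd_nat_card
  obtain ⟨j, -, hj⟩ := (Nat.dvd_prime_pow hp).1 h1
  have h2 : Monoid.exponent P ∣ p ^ f * r := by
    refine dvd_trans ?_ hH
    rw [← Monoid.exponent_multiplicative]
    exact Monoid.exponent_dvd_of_monoidHom (P : Subgroup (Multiplicative H)).subtype
      Subtype.val_injective
  rw [hj] at h2 ⊢
  have h3 : p ^ j ∣ p ^ f :=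
    (Nat.Coprime.pow_left j ((Nat.Prime.coprime_iff_not_dvd hp).2 hr)).dvd_of_dvd_mul_right h2
  exact pow_lt_pow_right₀ hp.one_lt (((Nat.pow_dvd_pow_iff_le_right hp.one_lt).1 h3).trans_lt hfe)

/-- A certificate for n with at most two prime factors, always through the power-of-q alternative
and never through self-conjugacy. The case q₁ = q₂ is allowed and serves n = 13². -/
theorem MultiplierHypotheses.of_prime_pow_mul {G : Type*} [AddCommGroup G] {v k l N n : ℕ} {t : ℤ}
    {q₁ q₂ a b m₁ m₂ w₁ w₂ j₁ j₂ : ℕ} (hN : AddMonoid.exponent G = N)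
    (ht : IsCoprime t (v : ℤ)) (hn : k - l = n) (hfac : n = q₁ ^ a * q₂ ^ b)
    (hq₁ : q₁.Prime) (hq₂ : q₂.Prime) (hN₁ : N = q₁ ^ m₁ * w₁) (hN₂ : N = q₂ ^ m₂ * w₂)
    (hw₁ : ¬ q₁ ∣ w₁) (hw₂ : ¬ q₂ ∣ w₂) (hj₁ : t ≡ (q₁ : ℤ) ^ j₁ [ZMOD (w₁ : ℤ)])
    (hj₂ : t ≡ (q₂ : ℤ) ^ j₂ [ZMOD (w₂ : ℤ)]) (hl : l * Nat.gcd n v < n) :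
    MultiplierHypotheses G v k l t := by
  have hfree {q m w : ℕ} (hq : q.Prime) (hNq : N = q ^ m * w) (hw : ¬ q ∣ w) :
      N / q ^ padicValNat q N = w := by
    have : Fact q.Prime := ⟨hq⟩
    have hw0 : w ≠ 0 := by rintro rfl; simp at hw
    rw [hNq, padicValNat.mul (pow_ne_zero _ hq.ne_zero) hw0, padicValNat.prime_pow,
      padicValNat.eq_zero_of_not_dvd hw, add_zero, Nat.mul_div_cancel_left _ (pow_pos hq.pos m)]
  refine ⟨ht, fun q hq hqn => Or.inr ?_, ?_⟩
  · rw [hn, hfac, hq.dvd_mul] at hqn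
    rw [hN]
    rcases hqn with h | h
    · obtain rfl := (Nat.prime_dvd_prime_iff_eq hq hq₁).1 (hq.dvd_of_dvd_pow h)
      rw [hfree hq hN₁ hw₁]
      exact ⟨j₁, hj₁⟩
    · obtain rfl := (Nat.prime_dvd_prime_iff_eq hq hq₂).1 (hq.dvd_of_dvd_pow h)
      rw [hfree hq hN₂ hw₂]
      exact ⟨j₂, hj₂⟩
  · have hn0 : 0 < n := by omega
    rw [hn, lt_div_iff₀ (by exact_mod_cast Nat.gcd_pos_of_pos_left _ hn0)]
    exact_mod_cast hl

/-- The multiplier theorem applied to a forbidden multiplier. -/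
theorem isRuledOut_of_multiplierHypotheses {G : Type} [AddCommGroup G] [DecidableEq G] [Finite G]
    {v k l p i : ℕ}
    (ht : MultiplierHypotheses G v k l ((AddMonoid.exponent G / p + 1 : ℕ) : ℤ))
    (hti : MultiplierHypotheses G v k l (((AddMonoid.exponent G / p + 1 : ℕ) : ℤ) ^ i))
    (hf : IsForbiddenMultiplier G v k l p (((AddMonoid.exponent G / p + 1 : ℕ) : ℤ) ^ i))
    (hlk : l ≤ k) (hk : k < p * (k - l)) (hineq : (p - 1) ^ 2 * (k - l) < (p * (k - l) - k) ^ 2)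
    (hfix : k.Coprime v ∨ p * l < k) : IsRuledOut G v k l p i := by
  refine ⟨?_, ht, hti, hf⟩
  rintro ⟨D, hD⟩
  obtain ⟨g, hg⟩ := hD.exists_translate_of_multiplierHypotheses hti
  obtain ⟨hp, ⟨e, H, _, he, -, ⟨f⟩, -, hs, hsH⟩, -⟩ := hf
  obtain ⟨φ, π, h⟩ := exists_isTransvection hp he f hs hsH
  exact h.not_multiplier hp hD hti.1 hlk hk hineq hfix g hg

theorem isForbiddenMultiplier_of_addEquiv {G : Type} [AddCommGroup G] {v k l p e f r : ℕ} {t : ℤ}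
    (hp : p.Prime) (he : 2 ≤ e) {H : Type} [AddCommGroup H] [Finite H]
    (φ : G ≃+ ZMod (p ^ e) × H) (hH : AddMonoid.exponent H = p ^ f * r) (hr : ¬ p ∣ r) (hfe : f < e)
    (ht : t ≡ 1 + (p : ℤ) ^ (e - 1) [ZMOD (p : ℤ) ^ e])
    (htH : t ≡ 1 [ZMOD ((p ^ f * r : ℕ) : ℤ)])
    (hnot : ¬ (p = 2 ∧ IsHadamardParameters v k l)) : IsForbiddenMultiplier G v k l p t :=
  ⟨hp, ⟨e, H, inferInstance, he, inferInstance, ⟨φ⟩,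
    fun P => exponent_sylow_lt hp hH.dvd hr hfe P, ht, by rwa [hH]⟩, fun h => hnot ⟨h.1, h.2.1⟩⟩

/-- Split off a coprime factor from the second cyclic component. -/
def zmodProdMulEquiv (a : ℕ) {m r : ℕ} (h : m.Coprime r) :
    ZMod a × ZMod (m * r) ≃+ ZMod m × (ZMod a × ZMod r) :=
  ((AddEquiv.refl (ZMod a)).prodCongr (ZMod.chineseRemainder h).toAddEquiv).trans
    (AddEquiv.prodAssoc.symm.trans
      ((AddEquiv.prodComm.prodCongr (AddEquiv.refl (ZMod r))).trans AddEquiv.prodAssoc))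

theorem exponent_zmod_prod (a b : ℕ) : AddMonoid.exponent (ZMod a × ZMod b) = Nat.lcm a b := by
  rw [AddMonoid.exponent_prod, ZMod.exponent, ZMod.exponent]
  rfl

/-! ### The six parameter sets -/

theorem not_isHadamardParameters_768 : ¬ IsHadamardParameters 768 118 18 := by
  rintro ⟨u, -, hu, -⟩
  have h1 : u < 14 := by nlinarith
  have h2 : 13 < u := by nlinarith
  omega

theorem isRuledOut_zmod7_prod_zmod49 : IsRuledOut (ZMod 7 × ZMod 49) 343 171 85 7 1 := by
  have hexp : AddMonoid.exponent (ZMod 7 × ZMod 49) = 49 := by rw [exponent_zmod_prod]; rfl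
  have ht : MultiplierHypotheses (ZMod 7 × ZMod 49) 343 171 85 8 :=
    .of_prime_pow_mul (n := 86) (q₁ := 2) (q₂ := 43) (a := 1) (b := 1) (m₁ := 0) (m₂ := 0)
      (w₁ := 49) (w₂ := 49) (j₁ := 3) (j₂ := 6) hexp
      (by norm_num [Int.isCoprime_iff_gcd_eq_one]) (by norm_num) (by norm_num) (by norm_num)
      (by norm_num) (by norm_num) (by norm_num) (by norm_num) (by norm_num)
      (by norm_num [Int.ModEq]) (by norm_num [Int.ModEq]) (by norm_num)
  have hf : IsForbiddenMultiplier (ZMod 7 × ZMod 49) 343 171 85 7 8 :=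
    isForbiddenMultiplier_of_addEquiv (e := 2) (f := 1) (r := 1) (by norm_num) (by norm_num)
      AddEquiv.prodComm (ZMod.exponent 7) (by norm_num) (by norm_num) (by norm_num [Int.ModEq])
      (by norm_num [Int.ModEq]) (by norm_num)
  refine isRuledOut_of_multiplierHypotheses ?_ ?_ ?_ (by norm_num) (by norm_num) (by norm_num)
    (Or.inl (by norm_num)) <;> rw [hexp] <;> assumption

theorem isRuledOut_zmod4_prod_zmod192 : IsRuledOut (ZMod 4 × ZMod 192) 768 118 18 2 1 := by
  have hexp : AddMonoid.exponent (ZMod 4 × ZMod 192) = 192 := by rw [exponent_zmod_prod]; rfl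
  have ht : MultiplierHypotheses (ZMod 4 × ZMod 192) 768 118 18 97 :=
    .of_prime_pow_mul (n := 100) (q₁ := 2) (q₂ := 5) (a := 2) (b := 2) (m₁ := 6) (m₂ := 0)
      (w₁ := 3) (w₂ := 192) (j₁ := 0) (j₂ := 8) hexp
      (by norm_num [Int.isCoprime_iff_gcd_eq_one]) (by norm_num) (by norm_num) (by norm_num)
      (by norm_num) (by norm_num) (by norm_num) (by norm_num) (by norm_num)
      (by norm_num [Int.ModEq]) (by norm_num [Int.ModEq]) (by norm_num)
  have hf : IsForbiddenMultiplier (ZMod 4 × ZMod 192) 768 118 18 2 97 :=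
    isForbiddenMultiplier_of_addEquiv (e := 6) (f := 2) (r := 3) (by norm_num) (by norm_num)
      (zmodProdMulEquiv 4 (m := 2 ^ 6) (r := 3) (by norm_num)) (exponent_zmod_prod 4 3)
      (by norm_num) (by norm_num) (by norm_num [Int.ModEq])
      (by norm_num [Int.ModEq]) (fun h => not_isHadamardParameters_768 h.2)
  -- Here gcd(118, 768) = 2, so the shift is located by pλ = 36 < 118 instead of coprimality.
  refine isRuledOut_of_multiplierHypotheses ?_ ?_ ?_ (by norm_num) (by norm_num) (by norm_num)
    (Or.inr (by norm_num)) <;> rw [hexp] <;> assumption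

theorem isRuledOut_zmod8_prod_zmod96 : IsRuledOut (ZMod 8 × ZMod 96) 768 118 18 2 1 := by
  have hexp : AddMonoid.exponent (ZMod 8 × ZMod 96) = 96 := by rw [exponent_zmod_prod]; rfl
  have ht : MultiplierHypotheses (ZMod 8 × ZMod 96) 768 118 18 49 :=
    .of_prime_pow_mul (n := 100) (q₁ := 2) (q₂ := 5) (a := 2) (b := 2) (m₁ := 5) (m₂ := 0)
      (w₁ := 3) (w₂ := 96) (j₁ := 0) (j₂ := 4) hexp
      (by norm_num [Int.isCoprime_iff_gcd_eq_one]) (by norm_num) (by norm_num) (by norm_num)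
      (by norm_num) (by norm_num) (by norm_num) (by norm_num) (by norm_num)
      (by norm_num [Int.ModEq]) (by norm_num [Int.ModEq]) (by norm_num)
  have hf : IsForbiddenMultiplier (ZMod 8 × ZMod 96) 768 118 18 2 49 :=
    isForbiddenMultiplier_of_addEquiv (e := 5) (f := 3) (r := 3) (by norm_num) (by norm_num)
      (zmodProdMulEquiv 8 (m := 2 ^ 5) (r := 3) (by norm_num)) (exponent_zmod_prod 8 3)
      (by norm_num) (by norm_num) (by norm_num [Int.ModEq])
      (by norm_num [Int.ModEq]) (fun h => not_isHadamardParameters_768 h.2)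
  refine isRuledOut_of_multiplierHypotheses ?_ ?_ ?_ (by norm_num) (by norm_num) (by norm_num)
    (Or.inr (by norm_num)) <;> rw [hexp] <;> assumption

theorem isRuledOut_zmod5859 : IsRuledOut (ZMod 5859) 5859 203 7 3 1 := by
  have hexp : AddMonoid.exponent (ZMod 5859) = 5859 := ZMod.exponent 5859
  have ht : MultiplierHypotheses (ZMod 5859) 5859 203 7 1954 :=
    .of_prime_pow_mul (n := 196) (q₁ := 2) (q₂ := 7) (a := 2) (b := 2) (m₁ := 0) (m₂ := 1)
      (w₁ := 5859) (w₂ := 837) (j₁ := 60) (j₂ := 15) hexp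
      (by norm_num [Int.isCoprime_iff_gcd_eq_one]) (by norm_num) (by norm_num) (by norm_num)
      (by norm_num) (by norm_num) (by norm_num) (by norm_num) (by norm_num)
      (by norm_num [Int.ModEq]) (by norm_num [Int.ModEq]) (by norm_num)
  have hf : IsForbiddenMultiplier (ZMod 5859) 5859 203 7 3 1954 :=
    isForbiddenMultiplier_of_addEquiv (e := 3) (f := 0) (r := 217) (by norm_num) (by norm_num)
      (ZMod.chineseRemainder (m := 3 ^ 3) (n := 217) (by norm_num)).toAddEquiv (ZMod.exponent 217)
      (by norm_num) (by norm_num) (by norm_num [Int.ModEq])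
      (by norm_num [Int.ModEq]) (by norm_num)
  have : NeZero 5859 := ⟨by norm_num⟩
  refine isRuledOut_of_multiplierHypotheses ?_ ?_ ?_ (by norm_num) (by norm_num) (by norm_num)
    (Or.inr (by norm_num)) <;> rw [hexp] <;> assumption

theorem isRuledOut_zmod5_prod_zmod135 : IsRuledOut (ZMod 5 × ZMod 135) 675 337 168 3 2 := by
  have hexp : AddMonoid.exponent (ZMod 5 × ZMod 135) = 135 := by rw [exponent_zmod_prod]; rfl
  have ht : MultiplierHypotheses (ZMod 5 × ZMod 135) 675 337 168 46 :=
    .of_prime_pow_mul (n := 169) (q₁ := 13) (q₂ := 13) (a := 1) (b := 1) (m₁ := 0) (m₂ := 0)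
      (w₁ := 135) (w₂ := 135) (j₁ := 24) (j₂ := 24) hexp
      (by norm_num [Int.isCoprime_iff_gcd_eq_one]) (by norm_num) (by norm_num) (by norm_num)
      (by norm_num) (by norm_num) (by norm_num) (by norm_num) (by norm_num)
      (by norm_num [Int.ModEq]) (by norm_num [Int.ModEq]) (by norm_num)
  -- The square is needed because 46 ≡ 1 + 2·9 modulo 27, whereas 46² ≡ 1 + 9. The exponent 12 is
  -- 2·24 reduced modulo 36, as 13^36 ≡ 1 modulo 135.
  have hti : MultiplierHypotheses (ZMod 5 × ZMod 135) 675 337 168 (46 ^ 2) :=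
    .of_prime_pow_mul (n := 169) (q₁ := 13) (q₂ := 13) (a := 1) (b := 1) (m₁ := 0) (m₂ := 0)
      (w₁ := 135) (w₂ := 135) (j₁ := 12) (j₂ := 12) hexp
      (by norm_num [Int.isCoprime_iff_gcd_eq_one]) (by norm_num) (by norm_num) (by norm_num)
      (by norm_num) (by norm_num) (by norm_num) (by norm_num) (by norm_num)
      (by norm_num [Int.ModEq]) (by norm_num [Int.ModEq]) (by norm_num)
  have hf : IsForbiddenMultiplier (ZMod 5 × ZMod 135) 675 337 168 3 (46 ^ 2) :=
    isForbiddenMultiplier_of_addEquiv (e := 3) (f := 0) (r := 5) (by norm_num) (by norm_num)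
      (zmodProdMulEquiv 5 (m := 3 ^ 3) (r := 5) (by norm_num)) (exponent_zmod_prod 5 5)
      (by norm_num) (by norm_num) (by norm_num [Int.ModEq])
      (by norm_num [Int.ModEq]) (by norm_num)
  refine isRuledOut_of_multiplierHypotheses ?_ ?_ ?_ (by norm_num) (by norm_num) (by norm_num)
    (Or.inl (by norm_num)) <;> rw [hexp] <;> assumption

theorem isRuledOut_zmod3_prod_zmod261 : IsRuledOut (ZMod 3 × ZMod 261) 783 391 195 3 2 := by
  have hexp : AddMonoid.exponent (ZMod 3 × ZMod 261) = 261 := by rw [exponent_zmod_prod]; rfl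
  have ht : MultiplierHypotheses (ZMod 3 × ZMod 261) 783 391 195 88 :=
    .of_prime_pow_mul (n := 196) (q₁ := 2) (q₂ := 7) (a := 2) (b := 2) (m₁ := 0) (m₂ := 0)
      (w₁ := 261) (w₂ := 261) (j₁ := 28) (j₂ := 7) hexp
      (by norm_num [Int.isCoprime_iff_gcd_eq_one]) (by norm_num) (by norm_num) (by norm_num)
      (by norm_num) (by norm_num) (by norm_num) (by norm_num) (by norm_num)
      (by norm_num [Int.ModEq]) (by norm_num [Int.ModEq]) (by norm_num)
  -- Again 88 ≡ 1 + 2·3 modulo 9, while 88² ≡ 1 + 3; both exponents simply double.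
  have hti : MultiplierHypotheses (ZMod 3 × ZMod 261) 783 391 195 (88 ^ 2) :=
    .of_prime_pow_mul (n := 196) (q₁ := 2) (q₂ := 7) (a := 2) (b := 2) (m₁ := 0) (m₂ := 0)
      (w₁ := 261) (w₂ := 261) (j₁ := 56) (j₂ := 14) hexp
      (by norm_num [Int.isCoprime_iff_gcd_eq_one]) (by norm_num) (by norm_num) (by norm_num)
      (by norm_num) (by norm_num) (by norm_num) (by norm_num) (by norm_num)
      (by norm_num [Int.ModEq]) (by norm_num [Int.ModEq]) (by norm_num)
  have hf : IsForbiddenMultiplier (ZMod 3 × ZMod 261) 783 391 195 3 (88 ^ 2) :=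
    isForbiddenMultiplier_of_addEquiv (e := 2) (f := 1) (r := 29) (by norm_num) (by norm_num)
      (zmodProdMulEquiv 3 (m := 3 ^ 2) (r := 29) (by norm_num)) (exponent_zmod_prod 3 29)
      (by norm_num) (by norm_num) (by norm_num [Int.ModEq])
      (by norm_num [Int.ModEq]) (by norm_num)
  refine isRuledOut_of_multiplierHypotheses ?_ ?_ ?_ (by norm_num) (by norm_num) (by norm_num)
    (Or.inl (by norm_num)) <;> rw [hexp] <;> assumption

theorem mainTheorem8 :
    IsRuledOut (ZMod 7 × ZMod 49) 343 171 85 7 1 ∧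
    IsRuledOut (ZMod 4 × ZMod 192) 768 118 18 2 1 ∧
    IsRuledOut (ZMod 8 × ZMod 96) 768 118 18 2 1 ∧
    IsRuledOut (ZMod 5859) 5859 203 7 3 1 ∧
    IsRuledOut (ZMod 5 × ZMod 135) 675 337 168 3 2 ∧
    IsRuledOut (ZMod 3 × ZMod 261) 783 391 195 3 2 :=
  ⟨isRuledOut_zmod7_prod_zmod49, isRuledOut_zmod4_prod_zmod192, isRuledOut_zmod8_prod_zmod96,
    isRuledOut_zmod5859, isRuledOut_zmod5_prod_zmod135, isRuledOut_zmod3_prod_zmod261⟩
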